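/- Let $d\ge 1$ and let $(p_t)_{t>0}$ be a symmetric convolution semigroup of probability densities on $\mathbb R^d$: $p_t(-x)=p_t(x)$ and $p_s*p_t=p_{s+t}$ almost everywhere, and $p_t(x)\,dx\to\delta_0$ weakly as $t\downarrow 0$. Write $p_c(x\mid\theta)=p_c(x-\theta)$ for the location model with location $\theta$ and scale parameter $c>0$. For a proper prior with density $\pi\ge 0$, $\int_{\mathbb R^d}\pi(\theta)\,d\theta=1$, let $$M^\pi(x)=M^\pi(x;c)=\int_{\mathbb R^d}p_c(x\mid\theta)\,\pi(\theta)\,d\theta$$ be the marginal density. The Bayes predictive density at scale $c$ under the uniform prior $\pi_U\equiv 1$ is $\hat p^{\pi_U}(y\mid x)=\int p_c(y\mid\theta)\,p_c(x\mid\theta)\,d\theta=p_{2c}(y-x)$ (for almost every $y$); let $\hat p_t^{\pi_U}(y\mid x)=p_t(y-x)$ be the corresponding transition density (time $t$ belongs to scale $t/2$), $T_tf(x)=\int f(y)\,\hat p_t^{\pi_U}(y\mid x)\,dy$ its semigroup on $L^2(\mathbb R^d)$, and let $(\mathcal E,\mathcal F)$ be the associated Dirichlet form, $$\mathcal F=\Bigl\{f\in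 L^2(\mathbb R^d):\ \lim_{t\downarrow 0}\tfrac1t\langle f-T_tf,f\rangle<\infty\Bigr\},\qquad \mathcal E(f,g)=\lim_{t\downarrow 0}\tfrac1t\langle f-T_tf,g\rangle\quad(f,g\in\mathcal F).$$ Then for every $c>0$ and every proper prior density $\pi$: 1. If $(p_t)$ is a location-scale family, i.e. for every $t>0$ there is $\sigma>0$ with $p_t(x)=\sigma^{-d}p_1(x/\sigma)$ for almost every $x$ (as for the normal, Cauchy and symmetric stable families), then $\sqrt{M^\pi}\in\mathcal F$. 2. If $\sqrt\pi\in\mathcal F$, then (for every such semigroup, location-scale or not) $\sqrt{M^\pi}\in\mathcal F$ and $$\mathcal E\bigl(\sqrt{M^\pi},\sqrt{M^\pi}\bigr)\le\mathcal E\bigl(\sqrt\pi,\sqrt\pi\bigr).$$ Thus, with the convention $\mathcal E(f,f)=+\infty$ for $f\in L^2(\mathbb R^d)\setminus\mathcal F$, the inequality holds for all proper prior densities $\pi$. -/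

import Mathlib

open MeasureTheory Filter Topology

noncomputable section

namespace PredictiveDirichlet

/-- `ℝ^d` with its Euclidean norm; integrals below are with respect to Lebesgue measure. -/
abbrev Space (d : ℕ) := EuclideanSpace ℝ (Fin d)

variable {d : ℕ}

/-- `p t` (for `t > 0`) is the Lebesgue density of the noise with scale parameter `t`, so that
`p_c(x | θ) = p c (x - θ)`.  The family is a symmetric convolution semigroup of probability
densities.  As usual, densities are only determined up to Lebesgue null sets. -/
structure IsSymmetricConvolutionFamily (p : ℝ → Space d → ℝ) : Prop where
  measurable : ∀ t, 0 < t → Measurable (p t)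
  nonneg : ∀ t, 0 < t → ∀ x, 0 ≤ p t x
  integral_eq_one : ∀ t, 0 < t → ∫ x, p t x = 1
  symm : ∀ t, 0 < t → ∀ᵐ x, p t (-x) = p t x
  conv : ∀ s t, 0 < s → 0 < t → ∀ᵐ x, p (s + t) x = ∫ y, p s (x - y) * p t y
  tendsto_dirac : ∀ r : ℝ, 0 < r →
    Tendsto (fun t => ∫ x in {x : Space d | r < ‖x‖}, p t x) (𝓝[>] 0) (𝓝 0)

/-- All members of the family are dilations of one another, that is, `p_c(x | θ)` is a
location-scale family.  The dilation factor `σ` need not be equal to the parameter `t`: for the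
normal family with covariance `t I` it is `√t`, for the Cauchy family it is `t`. -/
def IsScaleFamily (p : ℝ → Space d → ℝ) : Prop :=
  ∀ t, 0 < t → ∃ σ : ℝ, 0 < σ ∧ ∀ᵐ x, p t x = (σ ^ d)⁻¹ * p 1 (σ⁻¹ • x)

/-- A proper prior, given by its Lebesgue density. -/
structure IsProperPrior (prior : Space d → ℝ) : Prop where
  measurable : Measurable prior
  nonneg : ∀ θ, 0 ≤ prior θ
  integral_eq_one : ∫ θ, prior θ = 1

/-- The marginal density `M^π(x; c) = ∫ p_c(x | θ) π(θ) dθ`. -/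
def marginal (p : ℝ → Space d → ℝ) (c : ℝ) (prior : Space d → ℝ) (x : Space d) : ℝ :=
  ∫ θ, p c (x - θ) * prior θ

/-- The posterior density `π(θ | x)` after observing `x`. -/
def posterior (p : ℝ → Space d → ℝ) (c : ℝ) (prior : Space d → ℝ) (x θ : Space d) : ℝ :=
  p c (x - θ) * prior θ / marginal p c prior x

/-- The Bayes predictive density `p̂^π(y | x) = ∫ p_c(y | θ) π(θ | x) dθ`. -/
def predictive (p : ℝ → Space d → ℝ) (c : ℝ) (prior : Space d → ℝ) (x y : Space d) : ℝ :=
  ∫ θ, p c (y - θ) * posterior p c prior x θ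

/-- The predictive density under the uniform (improper) prior `π_U ≡ 1` as a transition density.
At scale `c` it belongs to time `t = 2 c`, hence the scale `t / 2`. -/
def transitionDensity (p : ℝ → Space d → ℝ) (t : ℝ) (x y : Space d) : ℝ :=
  predictive p (t / 2) (fun _ => 1) x y

/-- The transition semigroup `T_t f(x) = ∫ f(y) p̂_t^{π_U}(y | x) dy`. -/
def transitionSemigroup (p : ℝ → Space d → ℝ) (t : ℝ) (f : Space d → ℝ) (x : Space d) : ℝ :=
  ∫ y, f y * transitionDensity p t x y

/-- The approximating forms `𝓔^{(t)}(f, g) = t⁻¹ ⟨f - T_t f, g⟩` in `L²(ℝ^d)`. -/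
def approxForm (p : ℝ → Space d → ℝ) (t : ℝ) (f g : Space d → ℝ) : ℝ :=
  t⁻¹ * ∫ x, (f x - transitionSemigroup p t f x) * g x

/-- The domain `𝓕` of the Dirichlet form: the `f ∈ L²(ℝ^d)` for which `𝓔^{(t)}(f, f)` has a finite
limit as `t ↓ 0`. -/
def InDomain (p : ℝ → Space d → ℝ) (f : Space d → ℝ) : Prop :=
  MemLp f 2 volume ∧ ∃ l : ℝ, Tendsto (fun t => approxForm p t f f) (𝓝[>] 0) (𝓝 l)

/-- The Dirichlet form `𝓔(f, g) = lim_{t ↓ 0} 𝓔^{(t)}(f, g)` (for `f, g ∈ 𝓕`). -/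
def dirichletForm (p : ℝ → Space d → ℝ) (f g : Space d → ℝ) : ℝ :=
  limUnder (𝓝[>] (0 : ℝ)) fun t => approxForm p t f g

end PredictiveDirichlet

end

open PredictiveDirichlet

open scoped ENNReal

namespace PredictiveDirichlet

variable {d : ℕ}

/-! For a probability density `u`, put δ_u(t) = 1 - ⟨√u, T_t √u⟩ (`defect`), so that the
approximating form at √u is δ_u(t)/t. Since T_t is a symmetric contraction semigroup, δ_u is
nondecreasing; since 2δ_u(t) averages the squared distances ‖√u - √u(· + z)‖² over z ~ p_t, the
four-point inequality makes δ_u subadditive. Hence δ_u(t)/t converges as soon as it is bounded along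
some times tending to 0.

Cauchy-Schwarz gives √(m(x) m(x+z)) ≥ ∫ √(k(x-y) k(x+z-y)) ρ(y) dy for m = k * ρ, so mixing over
translates lowers the defect. The marginal is a mixture of translates of the prior with weight p_c,
which gives part 2. It is also a mixture of translates of p_c with weight the prior, so part 1
reduces to bounding the defect of p_c.

For independent X ~ p_a and Z ~ p_t, the log-density of X + Z at itself has the law of that of X at
itself, up to the shift d log r with r = σ(a+t)/σ(a). With log w ≤ w - 1 this gives δ_{p_a}(2t) ≤ d
log r (`one_sub_affinity_le`, `defect_dens_le`). Since δ_{p_a} decreases in the scale a, summing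
over a partition of [c/2, c] telescopes and gives δ_{p_c}(c/n) = O(1/n). -/

/-! ### Subadditive functions near zero, and truncated means -/

/-- Covering [0, t] by ⌊t/s⌋ + 1 steps of length s gives g(t)/t ≤ (1 + s/t) g(s)/s. Letting s tend
to 0 along the times in `hK` bounds the quotient everywhere by K, and the same inequality identifies
the limit as its supremum. -/
theorem exists_tendsto_inv_mul_of_subadditive {g : ℝ → ℝ} (h0 : ∀ t, 0 < t → 0 ≤ g t)
    (hmono : ∀ s t, 0 < s → s ≤ t → g s ≤ g t)
    (hsub : ∀ s t, 0 < s → 0 < t → g (s + t) ≤ g s + g t)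
    {K : ℝ} (hK : ∃ᶠ s in 𝓝[>] (0 : ℝ), g s ≤ K * s) :
    ∃ l, Tendsto (fun t => t⁻¹ * g t) (𝓝[>] 0) (𝓝 l) := by
  have hmul : ∀ s, 0 < s → ∀ n : ℕ, g ((n + 1 : ℕ) * s) ≤ (n + 1 : ℕ) * g s := by
    intro s hs n
    induction n with
    | zero => simp
    | succ n ih =>
      have h := hsub ((n + 1 : ℕ) * s) s (by positivity) hs
      have e : ((n + 1 + 1 : ℕ) : ℝ) * s = (n + 1 : ℕ) * s + s := by push_cast; ring
      rw [e]
      push_cast at *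
      linarith
  have hkey : ∀ s t, 0 < s → 0 < t → t⁻¹ * g t ≤ (1 + s / t) * (s⁻¹ * g s) := by
    intro s t hs ht
    have h1 : t ≤ (⌊t / s⌋₊ + 1 : ℕ) * s := by
      have := (Nat.lt_floor_add_one (t / s)).le
      rw [div_le_iff₀ hs] at this
      exact_mod_cast this
    have h2 := (hmono t _ ht h1).trans (hmul s hs _)
    have h3 : ((⌊t / s⌋₊ + 1 : ℕ) : ℝ) ≤ t / s + 1 := by
      push_cast
      linarith [Nat.floor_le (show 0 ≤ t / s by positivity)]
    have h4 := h2.trans (mul_le_mul_of_nonneg_right h3 (h0 s hs))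
    calc t⁻¹ * g t ≤ t⁻¹ * ((t / s + 1) * g s) := by gcongr
      _ = (1 + s / t) * (s⁻¹ * g s) := by field_simp
  have hlim : ∀ t : ℝ, 0 < t → Tendsto (fun s : ℝ => 1 + s / t) (𝓝[>] 0) (𝓝 1) := by
    intro t ht
    have : ContinuousAt (fun s : ℝ => 1 + s / t) 0 := by fun_prop
    have h := this.tendsto.mono_left (nhdsWithin_le_nhds (s := Set.Ioi 0))
    simpa using h
  have hbdd : ∀ t, 0 < t → t⁻¹ * g t ≤ K := by
    intro t ht
    by_contra! hlt
    have h1 : Tendsto (fun s : ℝ => (1 + s / t) * K) (𝓝[>] 0) (𝓝 K) := by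
      simpa using (hlim t ht).mul_const K
    obtain ⟨s, hsK, hs1, hs⟩ := (hK.and_eventually
      ((h1.eventually (gt_mem_nhds hlt)).and self_mem_nhdsWithin)).exists
    have hs : 0 < s := hs
    have h2 : s⁻¹ * g s ≤ K := by
      rw [inv_mul_le_iff₀ hs]; linarith
    have h3 := hkey s t hs ht
    have h4 : (1 + s / t) * (s⁻¹ * g s) ≤ (1 + s / t) * K := by gcongr
    linarith
  have hB : BddAbove ((fun t => t⁻¹ * g t) '' Set.Ioi 0) :=
    ⟨K, by rintro _ ⟨t, ht, rfl⟩; exact hbdd t ht⟩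
  refine ⟨sSup ((fun t => t⁻¹ * g t) '' Set.Ioi 0), tendsto_order.2 ⟨fun a ha => ?_, fun b hb => ?_⟩⟩
  · obtain ⟨_, ⟨t, ht, rfl⟩, hat⟩ := exists_lt_of_lt_csSup (Set.nonempty_Ioi.image _) ha
    have ht : 0 < t := ht
    have h1 : Tendsto (fun s : ℝ => (1 + s / t)⁻¹ * (t⁻¹ * g t)) (𝓝[>] 0) (𝓝 (t⁻¹ * g t)) := by
      simpa using ((hlim t ht).inv₀ one_ne_zero).mul_const (t⁻¹ * g t)
    filter_upwards [h1.eventually (lt_mem_nhds hat), self_mem_nhdsWithin] with s hs1 hs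
    have hs : 0 < s := hs
    refine hs1.trans_le ?_
    rw [inv_mul_le_iff₀ (by positivity)]
    exact hkey s t hs ht
  · filter_upwards [self_mem_nhdsWithin] with t ht
    exact (le_csSup hB ⟨t, ht, rfl⟩).trans_lt hb

/-- If `U` and `V` have the same truncated means, then a minorant of `U - V` has mean `≤ 0`; here
`U - V` itself need not be integrable. -/
theorem integral_nonpos_of_le_sub {Ω : Type*} [MeasurableSpace Ω] {P : Measure Ω}
    [IsProbabilityMeasure P] {U V Y : Ω → ℝ} (hU : Measurable U) (hV : Measurable V)
    (hY : Integrable Y P)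
    (hUV : ∀ N : ℕ, ∫ ω, max (-N : ℝ) (min N (U ω)) ∂P = ∫ ω, max (-N : ℝ) (min N (V ω)) ∂P)
    (hle : ∀ᵐ ω ∂P, Y ω ≤ U ω - V ω) : ∫ ω, Y ω ∂P ≤ 0 := by
  let tr : ℕ → ℝ → ℝ := fun N u => max (-N : ℝ) (min N u)
  have htr : ∀ N, Measurable (tr N) := fun N => by unfold tr; fun_prop
  have hbd : ∀ N u, ‖tr N u‖ ≤ N := fun N u => by
    have : (0 : ℝ) ≤ N := by positivity
    rw [Real.norm_eq_abs, abs_le]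
    exact ⟨le_max_left _ _, max_le (by linarith) (min_le_left _ _)⟩
  have hint : ∀ N (W : Ω → ℝ), Measurable W → Integrable (fun ω => tr N (W ω)) P := fun N W hW =>
    Integrable.of_bound ((htr N).comp hW).aestronglyMeasurable (N : ℝ)
      (Eventually.of_forall fun ω => hbd N _)
  have htrlim : ∀ u, ∀ᶠ N : ℕ in atTop, tr N u = u := fun u => by
    obtain ⟨M, hM⟩ := exists_nat_ge |u|
    filter_upwards [eventually_ge_atTop M] with N hN
    have h1 : |u| ≤ N := hM.trans (by exact_mod_cast hN)
    rw [abs_le] at h1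
    simp only [tr]
    rw [min_eq_right h1.2, max_eq_right h1.1]
  have hmono : ∀ N u v, u ≤ v → tr N u ≤ tr N v := fun N u v h =>
    max_le_max_left _ (min_le_min_left _ h)
  have hcontr : ∀ N u v, u ≤ v → u - v ≤ tr N u - tr N v := fun N u v h => by
    have hN : (0 : ℝ) ≤ N := by positivity
    simp only [tr]
    rcases max_cases (-N : ℝ) (min N u) with h1 | h1 <;>
    rcases max_cases (-N : ℝ) (min N v) with h2 | h2 <;>
    rcases min_cases (N : ℝ) u with h3 | h3 <;>
    rcases min_cases (N : ℝ) v with h4 | h4 <;> linarith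
  -- The minimum is dominated by |Y|: where U ≤ V, truncation only shrinks the negative difference,
  -- which lies above Y; where U ≥ V, the truncated difference is nonnegative. Pointwise the minimum
  -- is eventually Y.
  have hdom : Tendsto (fun N : ℕ => ∫ ω, min (Y ω) (tr N (U ω) - tr N (V ω)) ∂P) atTop
      (𝓝 (∫ ω, Y ω ∂P)) := by
    refine tendsto_integral_of_dominated_convergence (fun ω => |Y ω|) (fun N => ?_) hY.abs
      (fun N => ?_) ?_
    · exact hY.aestronglyMeasurable.inf
        ((hint N U hU).aestronglyMeasurable.sub (hint N V hV).aestronglyMeasurable)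
    · filter_upwards [hle] with ω h
      rw [Real.norm_eq_abs, abs_le]
      refine ⟨le_min (neg_abs_le _) ?_, (min_le_left _ _).trans (le_abs_self _)⟩
      rcases le_total (U ω) (V ω) with h1 | h1
      · exact (neg_abs_le _).trans (h.trans (hcontr N _ _ h1))
      · have := hmono N _ _ h1
        have := abs_nonneg (Y ω)
        linarith
    · filter_upwards [hle] with ω h
      refine tendsto_const_nhds.congr' ?_
      filter_upwards [htrlim (U ω), htrlim (V ω)] with N h1 h2
      rw [h1, h2, min_eq_left h]
  refine le_of_tendsto hdom (Eventually.of_forall fun N => ?_)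
  calc ∫ ω, min (Y ω) (tr N (U ω) - tr N (V ω)) ∂P
      ≤ ∫ ω, (tr N (U ω) - tr N (V ω)) ∂P :=
        integral_mono (hY.inf ((hint N U hU).sub (hint N V hV)))
          ((hint N U hU).sub (hint N V hV)) (fun ω => min_le_right _ _)
    _ = 0 := by rw [integral_sub (hint N U hU) (hint N V hV)]; exact sub_eq_zero.2 (hUV N)

/-! ### Autocorrelation functionals -/

/-- `∫ F(x) F(x + z) dx`. -/
noncomputable def autocorr (F : Space d → ℝ≥0∞) (z : Space d) : ℝ≥0∞ := ∫⁻ x, F x * F (x + z)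

/-- The autocorrelation averaged against `q`; this is `⟨F, q * F⟩`. -/
noncomputable def meanAutocorr (q F : Space d → ℝ≥0∞) : ℝ≥0∞ := ∫⁻ z, autocorr F z * q z

/-- The average of the translates of `F` with weight `q`. -/
noncomputable def smoothing (q F : Space d → ℝ≥0∞) (x : Space d) : ℝ≥0∞ := ∫⁻ y, F (x + y) * q y

/-- The squared `L²` distance of `f` from its translate by `z`. -/
noncomputable def sqDist (f : Space d → ℝ) (z : Space d) : ℝ≥0∞ :=
  ∫⁻ x, ENNReal.ofReal ((f x - f (x + z)) ^ 2)

theorem measurable_autocorr {F : Space d → ℝ≥0∞} (hF : Measurable F) :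
    Measurable (autocorr F) := by
  unfold autocorr
  exact Measurable.lintegral_prod_right' (f := fun a : Space d × Space d => F a.2 * F (a.2 + a.1))
    (by fun_prop)

theorem measurable_smoothing {q F : Space d → ℝ≥0∞} (hq : Measurable q) (hF : Measurable F) :
    Measurable (smoothing q F) := by
  unfold smoothing
  exact Measurable.lintegral_prod_right' (f := fun a : Space d × Space d => F (a.1 + a.2) * q a.2)
    (by fun_prop)

theorem measurable_sqDist {f : Space d → ℝ} (hf : Measurable f) : Measurable (sqDist f) := by
  unfold sqDist
  exact Measurable.lintegral_prod_right'
    (f := fun a : Space d × Space d => ENNReal.ofReal ((f a.2 - f (a.2 + a.1)) ^ 2)) (by fun_prop)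

theorem two_mul_mul_le_add_sq (a b : ℝ≥0∞) : 2 * (a * b) ≤ a ^ 2 + b ^ 2 := by
  rcases eq_or_ne a ∞ with rfl | ha
  · simp
  rcases eq_or_ne b ∞ with rfl | hb
  · simp
  lift a to NNReal using ha
  lift b to NNReal using hb
  have := two_mul_le_add_sq a b
  rw [mul_assoc] at this
  exact_mod_cast this

theorem autocorr_le {F : Space d → ℝ≥0∞} (hF : Measurable F) (z : Space d) :
    autocorr F z ≤ ∫⁻ x, F x ^ 2 := by
  have h : 2 * autocorr F z ≤ 2 * ∫⁻ x, F x ^ 2 := by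
    unfold autocorr
    rw [← lintegral_const_mul' _ _ (by simp)]
    calc _ ≤ ∫⁻ x, (F x ^ 2 + F (x + z) ^ 2) := lintegral_mono fun x => two_mul_mul_le_add_sq _ _
      _ = _ := by
        rw [lintegral_add_left (by fun_prop),
          lintegral_add_right_eq_self (fun x => F x ^ 2) z, two_mul]
  exact (ENNReal.mul_le_mul_iff_right (by simp) (by simp)).1 h

theorem meanAutocorr_le {q F : Space d → ℝ≥0∞} (hF : Measurable F) (hq : Measurable q)
    (hq1 : ∫⁻ x, q x = 1) : meanAutocorr q F ≤ ∫⁻ x, F x ^ 2 := by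
  calc meanAutocorr q F ≤ ∫⁻ z, (∫⁻ x, F x ^ 2) * q z :=
        lintegral_mono fun z => mul_le_mul_left (autocorr_le hF z) _
    _ = ∫⁻ x, F x ^ 2 := by rw [lintegral_const_mul _ hq, hq1, mul_one]

theorem sqDist_add_autocorr {f : Space d → ℝ} (hf : Measurable f) (h0 : ∀ x, 0 ≤ f x)
    (z : Space d) :
    sqDist f z + 2 * autocorr (fun x => ENNReal.ofReal (f x)) z
      = 2 * ∫⁻ x, ENNReal.ofReal (f x) ^ 2 := by
  have e : 2 * ∫⁻ x, ENNReal.ofReal (f x) ^ 2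
      = ∫⁻ x, (ENNReal.ofReal (f x) ^ 2 + ENNReal.ofReal (f (x + z)) ^ 2) := by
    rw [lintegral_add_left (by fun_prop),
      lintegral_add_right_eq_self (fun x => ENNReal.ofReal (f x) ^ 2) z, two_mul]
  unfold sqDist autocorr
  rw [e, ← lintegral_const_mul' _ _ (by simp), ← lintegral_add_left (by fun_prop)]
  refine lintegral_congr fun x => ?_
  have h1 := mul_nonneg (h0 x) (h0 (x + z))
  rw [← ENNReal.ofReal_mul (h0 _), ← ENNReal.ofReal_pow (h0 _), ← ENNReal.ofReal_pow (h0 _),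
    ← ENNReal.ofReal_add (by positivity) (by positivity), two_mul, ← ENNReal.ofReal_add h1 h1,
    ← ENNReal.ofReal_add (by positivity) (by positivity)]
  congr 1
  ring

/-- The quadrilateral inequality for the values of f at x, x+z, x+w, x+z+w: sides squared minus
diagonals squared is the square of the second difference. Translation invariance lets each distance
be read off on this quadrilateral. -/
theorem sqDist_add_sub_le {f : Space d → ℝ} (hf : Measurable f) (z w : Space d) :
    sqDist f (z + w) + sqDist f (z - w) ≤ 2 * sqDist f z + 2 * sqDist f w := by
  have e1 : sqDist f (z - w) = ∫⁻ x, ENNReal.ofReal ((f (x + w) - f (x + z)) ^ 2) := by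
    unfold sqDist
    rw [← lintegral_add_right_eq_self _ w]
    simp [add_assoc]
  have e2 : sqDist f z = ∫⁻ x, ENNReal.ofReal ((f (x + w) - f (x + (z + w))) ^ 2) := by
    unfold sqDist
    rw [← lintegral_add_right_eq_self _ w]
    simp [add_comm, add_left_comm]
  have e3 : sqDist f w = ∫⁻ x, ENNReal.ofReal ((f (x + z) - f (x + (z + w))) ^ 2) := by
    unfold sqDist
    rw [← lintegral_add_right_eq_self _ z]
    simp [add_assoc]
  rw [two_mul, two_mul, e1]
  nth_rewrite 2 [e2]
  nth_rewrite 2 [e3]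
  unfold sqDist
  rw [← lintegral_add_left (by fun_prop), ← lintegral_add_left (by fun_prop),
    ← lintegral_add_left (by fun_prop), ← lintegral_add_left (by fun_prop)]
  refine lintegral_mono fun x => ?_
  simp only
  rw [← ENNReal.ofReal_add (by positivity) (by positivity),
    ← ENNReal.ofReal_add (by positivity) (by positivity),
    ← ENNReal.ofReal_add (by positivity) (by positivity),
    ← ENNReal.ofReal_add (by positivity) (by positivity)]
  refine ENNReal.ofReal_le_ofReal ?_
  nlinarith [sq_nonneg (f x - f (x + z) - f (x + w) + f (x + (z + w)))]

/-- Cauchy-Schwarz for the weight `q`. -/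
theorem lintegral_sqrt_mul_sqrt_le {a b q : Space d → ℝ≥0∞} (ha : Measurable a)
    (hb : Measurable b) (hq : Measurable q) :
    ∫⁻ x, a x ^ (1 / 2 : ℝ) * b x ^ (1 / 2 : ℝ) * q x
      ≤ (∫⁻ x, a x * q x) ^ (1 / 2 : ℝ) * (∫⁻ x, b x * q x) ^ (1 / 2 : ℝ) := by
  have h := ENNReal.lintegral_mul_le_Lp_mul_Lq (volume.withDensity q)
    (Real.HolderConjugate.two_two) (f := fun x => a x ^ (1 / 2 : ℝ))
    (g := fun x => b x ^ (1 / 2 : ℝ)) (by fun_prop) (by fun_prop)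
  have e : ∀ u : ℝ≥0∞, (u ^ (1 / 2 : ℝ)) ^ (2 : ℝ) = u := fun u => by
    rw [← ENNReal.rpow_mul]; simp
  simp only [e, Pi.mul_apply] at h
  rw [lintegral_withDensity_eq_lintegral_mul _ hq (by fun_prop),
    lintegral_withDensity_eq_lintegral_mul _ hq (by fun_prop),
    lintegral_withDensity_eq_lintegral_mul _ hq (by fun_prop)] at h
  simpa [mul_comm] using h

/-- Convolving a density with a probability density increases the autocorrelation of its root. -/
theorem autocorr_sqrt_le_of_conv {k m ρ : Space d → ℝ≥0∞} (hk : Measurable k)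
    (hρ : Measurable ρ) (hρ1 : ∫⁻ x, ρ x = 1)
    (hm : ∀ᵐ x, m x = ∫⁻ y, k (x - y) * ρ y) (z : Space d) :
    autocorr (fun x => k x ^ (1 / 2 : ℝ)) z ≤ autocorr (fun x => m x ^ (1 / 2 : ℝ)) z := by
  have hm' : ∀ᵐ x, m (x + z) = ∫⁻ y, k (x + z - y) * ρ y :=
    (measurePreserving_add_right volume z).quasiMeasurePreserving.ae hm
  calc autocorr (fun x => k x ^ (1 / 2 : ℝ)) z
      = ∫⁻ y, autocorr (fun x => k x ^ (1 / 2 : ℝ)) z * ρ y := by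
        rw [lintegral_const_mul _ hρ, hρ1, mul_one]
    _ = ∫⁻ y, ∫⁻ x, k (x - y) ^ (1 / 2 : ℝ) * k (x + z - y) ^ (1 / 2 : ℝ) * ρ y := by
        refine lintegral_congr fun y => ?_
        rw [lintegral_mul_const _ (by fun_prop)]
        unfold autocorr
        rw [← lintegral_sub_right_eq_self _ y]
        simp [sub_add_eq_add_sub]
    _ = ∫⁻ x, ∫⁻ y, k (x - y) ^ (1 / 2 : ℝ) * k (x + z - y) ^ (1 / 2 : ℝ) * ρ y :=
        lintegral_lintegral_swap (by fun_prop)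
    _ ≤ autocorr (fun x => m x ^ (1 / 2 : ℝ)) z := by
        refine lintegral_mono_ae ?_
        filter_upwards [hm, hm'] with x h1 h2
        rw [h1, h2]
        exact lintegral_sqrt_mul_sqrt_le (by fun_prop) (by fun_prop) hρ

theorem meanAutocorr_sqrt_le_of_conv {q k m ρ : Space d → ℝ≥0∞} (hk : Measurable k)
    (hρ : Measurable ρ) (hρ1 : ∫⁻ x, ρ x = 1) (hm : ∀ᵐ x, m x = ∫⁻ y, k (x - y) * ρ y) :
    meanAutocorr q (fun x => k x ^ (1 / 2 : ℝ)) ≤ meanAutocorr q (fun x => m x ^ (1 / 2 : ℝ)) :=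
  lintegral_mono fun z => mul_le_mul_left (autocorr_sqrt_le_of_conv hk hρ hρ1 hm z) _

/-! ### Convolution identities with values in [0, ∞] -/

theorem lintegral_ofReal_eq_one {u : Space d → ℝ} (h0 : ∀ x, 0 ≤ u x) (h1 : ∫ x, u x = 1) :
    ∫⁻ x, ENNReal.ofReal (u x) = 1 := by
  have hint : Integrable u := by
    by_contra h
    simp [integral_undef h] at h1
  rw [← ofReal_integral_eq_lintegral_ofReal hint (Eventually.of_forall h0), h1, ENNReal.ofReal_one]

/-- The Bochner integral is 0 where the integrand is not integrable, so the identity is only almost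
everywhere; by Tonelli the right-hand side has finite total mass, hence is finite almost everywhere.
-/
theorem ofReal_integral_conv {k ρ : Space d → ℝ} (hk : Measurable k) (hρ : Measurable ρ)
    (hk0 : ∀ x, 0 ≤ k x) (hρ0 : ∀ x, 0 ≤ ρ x) (hk1 : ∫ x, k x = 1) (hρ1 : ∫ x, ρ x = 1) :
    ∀ᵐ x, ENNReal.ofReal (∫ y, k (x - y) * ρ y)
      = ∫⁻ y, ENNReal.ofReal (k (x - y)) * ENNReal.ofReal (ρ y) := by
  have hfin : ∫⁻ x, ∫⁻ y, ENNReal.ofReal (k (x - y)) * ENNReal.ofReal (ρ y) ≠ ∞ := by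
    rw [lintegral_lintegral_swap (by fun_prop)]
    have : ∀ y, ∫⁻ x, ENNReal.ofReal (k (x - y)) * ENNReal.ofReal (ρ y)
        = ENNReal.ofReal (ρ y) := fun y => by
      rw [lintegral_mul_const _ (by fun_prop),
        lintegral_sub_right_eq_self (fun x => ENNReal.ofReal (k x)) y,
        lintegral_ofReal_eq_one hk0 hk1, one_mul]
    simp [this, lintegral_ofReal_eq_one hρ0 hρ1]
  have hmeas : Measurable fun x => ∫⁻ y, ENNReal.ofReal (k (x - y)) * ENNReal.ofReal (ρ y) :=
    Measurable.lintegral_prod_right'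
      (f := fun a : Space d × Space d => ENNReal.ofReal (k (a.1 - a.2)) * ENNReal.ofReal (ρ a.2))
      (by fun_prop)
  filter_upwards [ae_lt_top hmeas hfin] with x hx
  rw [integral_eq_lintegral_of_nonneg_ae (Eventually.of_forall fun y => mul_nonneg (hk0 _) (hρ0 _))
    (by fun_prop)]
  simp_rw [ENNReal.ofReal_mul (hk0 _)]
  exact ENNReal.ofReal_toReal hx.ne

theorem lintegral_conv_comm (k ρ : Space d → ℝ≥0∞) (x : Space d) :
    ∫⁻ y, k (x - y) * ρ y = ∫⁻ y, ρ (x - y) * k y := by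
  rw [← lintegral_sub_left_eq_self _ x]
  simp [mul_comm]

/-- The density `p t` with values in `ℝ≥0∞`. -/
noncomputable def dens (p : ℝ → Space d → ℝ) (t : ℝ) (x : Space d) : ℝ≥0∞ := ENNReal.ofReal (p t x)

/-! ### Monotonicity and subadditivity along the semigroup -/

namespace IsSymmetricConvolutionFamily

variable {p : ℝ → Space d → ℝ} (hp : IsSymmetricConvolutionFamily p)
include hp

theorem measurable_dens {t : ℝ} (ht : 0 < t) : Measurable (dens p t) :=
  (hp.measurable t ht).ennreal_ofReal

theorem lintegral_dens {t : ℝ} (ht : 0 < t) : ∫⁻ x, dens p t x = 1 :=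
  lintegral_ofReal_eq_one (hp.nonneg t ht) (hp.integral_eq_one t ht)

theorem dens_neg {t : ℝ} (ht : 0 < t) : ∀ᵐ x, dens p t (-x) = dens p t x := by
  filter_upwards [hp.symm t ht] with x hx
  simp [dens, hx]

theorem lintegral_neg_dens {t : ℝ} (ht : 0 < t) (Φ : Space d → ℝ≥0∞) :
    ∫⁻ x, Φ (-x) * dens p t x = ∫⁻ x, Φ x * dens p t x := by
  rw [← lintegral_neg_eq_self (fun x => Φ x * dens p t x)]
  refine lintegral_congr_ae ?_
  filter_upwards [hp.dens_neg ht] with x hx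
  rw [hx]

theorem dens_add {s t : ℝ} (hs : 0 < s) (ht : 0 < t) :
    ∀ᵐ x, dens p (s + t) x = ∫⁻ y, dens p s (x - y) * dens p t y := by
  filter_upwards [hp.conv s t hs ht, ofReal_integral_conv (hp.measurable s hs) (hp.measurable t ht)
    (hp.nonneg s hs) (hp.nonneg t ht) (hp.integral_eq_one s hs) (hp.integral_eq_one t ht)]
    with x h1 h2
  unfold dens
  rw [h1, h2]

theorem lintegral_dens_add {s t : ℝ} (hs : 0 < s) (ht : 0 < t) {Φ : Space d → ℝ≥0∞}
    (hΦ : Measurable Φ) :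
    ∫⁻ x, Φ x * dens p (s + t) x = ∫⁻ y, ∫⁻ x, Φ (x + y) * dens p s x * dens p t y := by
  have ms := hp.measurable_dens hs
  have mt := hp.measurable_dens ht
  calc ∫⁻ x, Φ x * dens p (s + t) x
      = ∫⁻ x, ∫⁻ y, Φ x * dens p s (x - y) * dens p t y := by
        refine lintegral_congr_ae ?_
        filter_upwards [hp.dens_add hs ht] with x hx
        rw [hx, ← lintegral_const_mul _ (by fun_prop)]
        simp [mul_assoc]
    _ = ∫⁻ y, ∫⁻ x, Φ x * dens p s (x - y) * dens p t y := lintegral_lintegral_swap (by fun_prop)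
    _ = _ := by
        refine lintegral_congr fun y => ?_
        rw [← lintegral_add_right_eq_self _ y]
        simp

/-- The semigroup is symmetric, so `⟨F, T_{2t} F⟩ = ‖T_t F‖²`. -/
theorem meanAutocorr_two_mul {t : ℝ} (ht : 0 < t) {F : Space d → ℝ≥0∞} (hF : Measurable F) :
    meanAutocorr (dens p (2 * t)) F = ∫⁻ x, smoothing (dens p t) F x ^ 2 := by
  have mt := hp.measurable_dens ht
  have hR := measurable_autocorr hF
  unfold meanAutocorr
  rw [two_mul, hp.lintegral_dens_add ht ht hR]
  calc ∫⁻ y, ∫⁻ x, autocorr F (x + y) * dens p t x * dens p t y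
      = ∫⁻ y, (∫⁻ x, autocorr F (x + y) * dens p t x) * dens p t y :=
        lintegral_congr fun y => lintegral_mul_const _ (by fun_prop)
    -- Reflecting one noise variable lets a shift by x separate the integrand into a factor in x and
    -- a factor in y.
    _ = ∫⁻ y, (∫⁻ x, autocorr F (-x + y) * dens p t x) * dens p t y := by
        refine lintegral_congr fun y => ?_
        rw [hp.lintegral_neg_dens ht (fun x => autocorr F (x + y))]
    _ = ∫⁻ y, ∫⁻ x, ∫⁻ w, F (w + x) * dens p t x * (F (w + y) * dens p t y) := by
        refine lintegral_congr fun y => ?_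
        rw [← lintegral_mul_const _ (by fun_prop)]
        refine lintegral_congr fun x => ?_
        unfold autocorr
        rw [← lintegral_add_right_eq_self _ x, ← lintegral_mul_const _ (by fun_prop),
          ← lintegral_mul_const _ (by fun_prop)]
        refine lintegral_congr fun w => ?_
        rw [show w + x + (-x + y) = w + y by abel]
        ring
    _ = ∫⁻ y, ∫⁻ w, ∫⁻ x, F (w + x) * dens p t x * (F (w + y) * dens p t y) :=
        lintegral_congr fun y => lintegral_lintegral_swap (by fun_prop)
    _ = ∫⁻ y, ∫⁻ w, smoothing (dens p t) F w * (F (w + y) * dens p t y) :=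
        lintegral_congr fun y => lintegral_congr fun w => lintegral_mul_const _ (by fun_prop)
    _ = ∫⁻ w, ∫⁻ y, smoothing (dens p t) F w * (F (w + y) * dens p t y) := by
        have := measurable_smoothing mt hF
        exact lintegral_lintegral_swap (by fun_prop)
    _ = _ := by
        refine lintegral_congr fun w => ?_
        rw [lintegral_const_mul _ (by fun_prop), sq]
        rfl

theorem smoothing_add {s t : ℝ} (hs : 0 < s) (ht : 0 < t) {F : Space d → ℝ≥0∞}
    (hF : Measurable F) :
    smoothing (dens p (s + t)) F = smoothing (dens p t) (smoothing (dens p s) F) := by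
  have ms := hp.measurable_dens hs
  ext x
  unfold smoothing
  rw [hp.lintegral_dens_add hs ht (Φ := fun y => F (x + y)) (by fun_prop)]
  refine lintegral_congr fun y => ?_
  rw [lintegral_mul_const _ (by fun_prop)]
  simp only [add_comm, add_left_comm]

/-- With S = T_{s/2} F, the two sides are ⟨S, T_{t-s} S⟩ and ‖S‖², and averaged autocorrelations
never exceed the squared norm. -/
theorem meanAutocorr_anti {s t : ℝ} (hs : 0 < s) (hst : s ≤ t) {F : Space d → ℝ≥0∞}
    (hF : Measurable F) : meanAutocorr (dens p t) F ≤ meanAutocorr (dens p s) F := by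
  rcases hst.eq_or_lt with rfl | hlt
  · rfl
  have h1 : 0 < s / 2 := by linarith
  have h2 : 0 < (t - s) / 2 := by linarith
  have mS := measurable_smoothing (hp.measurable_dens h1) hF
  rw [show t = 2 * (s / 2 + (t - s) / 2) by ring, show meanAutocorr (dens p s) F
    = meanAutocorr (dens p (2 * (s / 2))) F by congr 2; ring,
    hp.meanAutocorr_two_mul (by positivity) hF, hp.meanAutocorr_two_mul h1 hF,
    hp.smoothing_add h1 h2 hF, ← hp.meanAutocorr_two_mul h2 mS]
  exact meanAutocorr_le mS (hp.measurable_dens (by positivity)) (hp.lintegral_dens (by positivity))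

/-- For independent noises x ~ p_s and y ~ p_t, symmetry gives x + y and x - y the same law p_{s+t};
the claim is the mean of `sqDist_add_sub_le`, divided by 2. -/
theorem lintegral_sqDist_add_le {s t : ℝ} (hs : 0 < s) (ht : 0 < t) {f : Space d → ℝ}
    (hf : Measurable f) :
    ∫⁻ z, sqDist f z * dens p (s + t) z
      ≤ (∫⁻ z, sqDist f z * dens p s z) + ∫⁻ z, sqDist f z * dens p t z := by
  have ms := hp.measurable_dens hs
  have mt := hp.measurable_dens ht
  have hD := measurable_sqDist hf
  have e1 := hp.lintegral_dens_add hs ht hD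
  have e2 : ∫⁻ z, sqDist f z * dens p (s + t) z
      = ∫⁻ y, ∫⁻ x, sqDist f (x - y) * dens p s x * dens p t y := by
    rw [e1, lintegral_lintegral_swap (by fun_prop),
      lintegral_lintegral_swap (f := fun y x => sqDist f (x - y) * dens p s x * dens p t y)
        (by fun_prop)]
    refine lintegral_congr fun x => ?_
    simpa [sub_eq_add_neg] using
      (hp.lintegral_neg_dens ht (fun y => sqDist f (x + y) * dens p s x)).symm
  have h : 2 * ∫⁻ z, sqDist f z * dens p (s + t) z
      ≤ 2 * ((∫⁻ z, sqDist f z * dens p s z) + ∫⁻ z, sqDist f z * dens p t z) := by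
    calc 2 * ∫⁻ z, sqDist f z * dens p (s + t) z
        = ∫⁻ y, ∫⁻ x, (sqDist f (x + y) + sqDist f (x - y)) * dens p s x * dens p t y := by
          rw [two_mul]
          nth_rewrite 1 [e1]
          rw [e2, ← lintegral_add_left (Measurable.lintegral_prod_right' (f := fun a :
            Space d × Space d => sqDist f (a.2 + a.1) * dens p s a.2 * dens p t a.1) (by fun_prop))]
          refine lintegral_congr fun y => ?_
          rw [← lintegral_add_left (by fun_prop)]
          simp [add_mul]
      _ ≤ ∫⁻ y, ∫⁻ x, (2 * sqDist f x + 2 * sqDist f y) * dens p s x * dens p t y := by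
          refine lintegral_mono fun y => lintegral_mono fun x =>
            mul_le_mul_left (mul_le_mul_left ?_ _) _
          exact sqDist_add_sub_le hf x y
      _ = ∫⁻ y, (2 * (∫⁻ x, sqDist f x * dens p s x) + 2 * sqDist f y) * dens p t y := by
          refine lintegral_congr fun y => ?_
          rw [lintegral_mul_const _ (by fun_prop)]
          congr 1
          simp_rw [add_mul]
          rw [lintegral_add_left (by fun_prop), lintegral_const_mul _ ms, hp.lintegral_dens hs,
            mul_one, ← lintegral_const_mul _ (by fun_prop)]
          simp [mul_assoc]
      _ = _ := by
          simp_rw [add_mul]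
          rw [lintegral_add_left (by fun_prop), lintegral_const_mul _ mt, hp.lintegral_dens ht,
            mul_one, mul_add, ← lintegral_const_mul 2 (f := fun z => sqDist f z * dens p t z)
            (by fun_prop)]
          simp [mul_assoc]
  exact (ENNReal.mul_le_mul_iff_right (by simp) (by simp)).1 h

end IsSymmetricConvolutionFamily

/-! ### The form on square roots of probability densities -/

/-- `⟨f - T_t f, f⟩` for `f = √u`, where `u` is a probability density. -/
noncomputable def defect (p : ℝ → Space d → ℝ) (u : Space d → ℝ) (t : ℝ) : ℝ :=
  1 - (meanAutocorr (dens p t) (fun x => ENNReal.ofReal √(u x))).toReal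

namespace IsProperPrior

variable {u : Space d → ℝ} (hu : IsProperPrior u)
include hu

theorem lintegral_sqrt_sq : ∫⁻ x, ENNReal.ofReal √(u x) ^ 2 = 1 := by
  rw [← lintegral_ofReal_eq_one hu.nonneg hu.integral_eq_one]
  refine lintegral_congr fun x => ?_
  rw [← ENNReal.ofReal_pow (Real.sqrt_nonneg _), Real.sq_sqrt (hu.nonneg x)]

theorem measurable_sqrt : Measurable fun x => √(u x) := hu.measurable.sqrt

theorem memLp_sqrt : MemLp (fun x => √(u x)) 2 := by
  rw [memLp_two_iff_integrable_sq hu.measurable_sqrt.aestronglyMeasurable]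
  simp_rw [Real.sq_sqrt (hu.nonneg _)]
  by_contra h
  have := hu.integral_eq_one
  simp [integral_undef h] at this

variable {p : ℝ → Space d → ℝ} (hp : IsSymmetricConvolutionFamily p)
include hp

theorem meanAutocorr_le_one {t : ℝ} (ht : 0 < t) :
    meanAutocorr (dens p t) (fun x => ENNReal.ofReal √(u x)) ≤ 1 := by
  rw [← hu.lintegral_sqrt_sq]
  exact meanAutocorr_le hu.measurable_sqrt.ennreal_ofReal (hp.measurable_dens ht)
    (hp.lintegral_dens ht)

theorem defect_nonneg {t : ℝ} (ht : 0 < t) : 0 ≤ defect p u t := by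
  have := ENNReal.toReal_mono ENNReal.one_ne_top (hu.meanAutocorr_le_one hp ht)
  unfold defect
  simp at this
  linarith

theorem defect_mono {s t : ℝ} (hs : 0 < s) (hst : s ≤ t) : defect p u s ≤ defect p u t := by
  have := ENNReal.toReal_mono ((hu.meanAutocorr_le_one hp hs).trans_lt ENNReal.one_lt_top).ne
    (hp.meanAutocorr_anti hs hst hu.measurable_sqrt.ennreal_ofReal)
  unfold defect
  linarith

theorem lintegral_sqDist_add {t : ℝ} (ht : 0 < t) :
    (∫⁻ z, sqDist (fun x => √(u x)) z * dens p t z)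
      + 2 * meanAutocorr (dens p t) (fun x => ENNReal.ofReal √(u x)) = 2 := by
  have mt := hp.measurable_dens ht
  have h1 := measurable_sqDist hu.measurable_sqrt
  have h2 := measurable_autocorr hu.measurable_sqrt.ennreal_ofReal
  unfold meanAutocorr
  rw [← lintegral_const_mul _ (by fun_prop), ← lintegral_add_left (by fun_prop)]
  simp_rw [← mul_assoc, ← add_mul, sqDist_add_autocorr hu.measurable_sqrt
    (fun x => Real.sqrt_nonneg _), hu.lintegral_sqrt_sq]
  rw [lintegral_const_mul _ mt, hp.lintegral_dens ht]
  simp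

theorem two_mul_defect {t : ℝ} (ht : 0 < t) :
    2 * defect p u t = (∫⁻ z, sqDist (fun x => √(u x)) z * dens p t z).toReal := by
  have h := hu.lintegral_sqDist_add hp ht
  have h3 := congrArg ENNReal.toReal h
  rw [ENNReal.toReal_add (ne_top_of_le_ne_top (by simp) (le_self_add.trans h.le))
    (ne_top_of_le_ne_top (by simp) (le_add_self.trans h.le)), ENNReal.toReal_mul] at h3
  simp only [ENNReal.toReal_ofNat] at h3
  unfold defect
  linarith

theorem defect_add_le {s t : ℝ} (hs : 0 < s) (ht : 0 < t) :
    defect p u (s + t) ≤ defect p u s + defect p u t := by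
  have hfin : ∀ r, 0 < r → ∫⁻ z, sqDist (fun x => √(u x)) z * dens p r z ≠ ∞ := fun r hr =>
    ne_top_of_le_ne_top (by simp) (le_self_add.trans (hu.lintegral_sqDist_add hp hr).le)
  have h := ENNReal.toReal_mono (ENNReal.add_ne_top.2 ⟨hfin s hs, hfin t ht⟩)
    (hp.lintegral_sqDist_add_le hs ht hu.measurable_sqrt)
  rw [ENNReal.toReal_add (hfin s hs) (hfin t ht), ← hu.two_mul_defect hp hs,
    ← hu.two_mul_defect hp ht, ← hu.two_mul_defect hp (by positivity)] at h
  linarith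

theorem exists_tendsto_defect {K : ℝ} (hK : ∃ᶠ s in 𝓝[>] (0 : ℝ), defect p u s ≤ K * s) :
    ∃ l, Tendsto (fun t => t⁻¹ * defect p u t) (𝓝[>] 0) (𝓝 l) :=
  exists_tendsto_inv_mul_of_subadditive (fun _ => hu.defect_nonneg hp)
    (fun _ _ => hu.defect_mono hp) (fun _ _ => hu.defect_add_le hp) hK

end IsProperPrior

theorem ofReal_sqrt_eq_rpow {a : ℝ} (ha : 0 ≤ a) :
    ENNReal.ofReal √a = ENNReal.ofReal a ^ (1 / 2 : ℝ) := by
  rw [Real.sqrt_eq_rpow, ENNReal.ofReal_rpow_of_nonneg ha (by norm_num)]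

theorem lintegral_comp_smul_mul {r : ℝ} (hr : 0 < r) {f : Space d → ℝ≥0∞} (hf : Measurable f) :
    ∫⁻ x, f (r • x) * ENNReal.ofReal (r ^ d) = ∫⁻ x, f x := by
  have h : Measurable fun x : Space d => r • x := measurable_const_smul r
  rw [lintegral_mul_const _ (by fun_prop), ← lintegral_map hf h,
    Measure.map_addHaar_smul volume hr.ne', lintegral_smul_measure, finrank_euclideanSpace_fin,
    abs_of_pos (by positivity), smul_eq_mul, mul_right_comm, ← ENNReal.ofReal_mul (by positivity),
    inv_mul_cancel₀ (by positivity), ENNReal.ofReal_one, one_mul]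

theorem meanAutocorr_eq_lintegral {q F : Space d → ℝ≥0∞} (hq : Measurable q) (hF : Measurable F) :
    meanAutocorr q F = ∫⁻ x, (∫⁻ y, F y * q (y - x)) * F x := by
  unfold meanAutocorr autocorr
  calc ∫⁻ z, (∫⁻ x, F x * F (x + z)) * q z = ∫⁻ z, ∫⁻ x, F x * F (x + z) * q z :=
        lintegral_congr fun z => (lintegral_mul_const _ (by fun_prop)).symm
    _ = ∫⁻ x, ∫⁻ z, F x * F (x + z) * q z := lintegral_lintegral_swap (by fun_prop)
    _ = _ := by
        refine lintegral_congr fun x => ?_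
        rw [← lintegral_mul_const _ (by fun_prop), ← lintegral_sub_right_eq_self _ x]
        refine lintegral_congr fun y => ?_
        simp only [add_sub_cancel]
        ring

/-! ### Identification of the approximating forms with the defect -/

variable {p : ℝ → Space d → ℝ}

theorem IsSymmetricConvolutionFamily.isProperPrior (hp : IsSymmetricConvolutionFamily p) {t : ℝ}
    (ht : 0 < t) : IsProperPrior (p t) :=
  ⟨hp.measurable t ht, hp.nonneg t ht, hp.integral_eq_one t ht⟩

/-- Under the uniform prior the marginal is 1, so the posterior is p_{t/2}(x - θ); a substitution
and symmetry turn the predictive integral into p_{t/2} * p_{t/2} at y - x. -/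
theorem IsSymmetricConvolutionFamily.transitionDensity_ae_eq (hp : IsSymmetricConvolutionFamily p)
    {t : ℝ} (ht : 0 < t) (x : Space d) : ∀ᵐ y, transitionDensity p t x y = p t (y - x) := by
  have h2 : 0 < t / 2 := by linarith
  have hm : marginal p (t / 2) (fun _ => 1) x = 1 := by
    unfold marginal
    simp only [mul_one]
    rw [integral_sub_left_eq_self (p (t / 2)) volume x, hp.integral_eq_one _ h2]
  have hc := (measurePreserving_sub_right volume x).quasiMeasurePreserving.ae (hp.conv _ _ h2 h2)
  filter_upwards [hc] with y hy
  rw [add_halves] at hy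
  rw [hy]
  unfold transitionDensity predictive posterior
  rw [hm]
  simp only [mul_one, div_one]
  rw [← integral_sub_left_eq_self (fun θ => p (t / 2) (y - θ) * p (t / 2) (x - θ)) volume x,
    ← integral_neg_eq_self]
  refine integral_congr_ae ?_
  filter_upwards [hp.symm _ h2] with θ hθ
  simp only [sub_sub_cancel, hθ]
  congr 2
  abel

namespace IsProperPrior

variable {u : Space d → ℝ} (hu : IsProperPrior u)
include hu

theorem transitionSemigroup_sqrt (hp : IsSymmetricConvolutionFamily p) {t : ℝ} (ht : 0 < t)
    (x : Space d) : transitionSemigroup p t (fun x => √(u x)) x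
      = (∫⁻ y, ENNReal.ofReal √(u y) * dens p t (y - x)).toReal := by
  have hpt := hp.measurable t ht
  have hsq := hu.measurable_sqrt
  unfold transitionSemigroup
  rw [integral_congr_ae (g := fun y => √(u y) * p t (y - x)) (by
    filter_upwards [hp.transitionDensity_ae_eq ht x] with y hy
    rw [hy]), integral_eq_lintegral_of_nonneg_ae
    (Eventually.of_forall fun y => mul_nonneg (Real.sqrt_nonneg _) (hp.nonneg t ht _))
    (by fun_prop)]
  simp_rw [ENNReal.ofReal_mul (Real.sqrt_nonneg _)]
  rfl

theorem approxForm_sqrt (hp : IsSymmetricConvolutionFamily p) {t : ℝ} (ht : 0 < t) :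
    approxForm p t (fun x => √(u x)) (fun x => √(u x)) = t⁻¹ * defect p u t := by
  have mu := hu.measurable
  have mF := hu.measurable_sqrt.ennreal_ofReal
  have mq := hp.measurable_dens ht
  set A : Space d → ℝ≥0∞ := fun x => ∫⁻ y, ENNReal.ofReal √(u y) * dens p t (y - x) with hA
  have mA : Measurable A := Measurable.lintegral_prod_right' (f := fun a : Space d × Space d =>
    ENNReal.ofReal √(u a.2) * dens p t (a.2 - a.1)) (by fun_prop)
  have hφ : ∫⁻ x, A x * ENNReal.ofReal √(u x)
      = meanAutocorr (dens p t) (fun x => ENNReal.ofReal √(u x)) :=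
    (meanAutocorr_eq_lintegral mq mF).symm
  have hle := hu.meanAutocorr_le_one hp ht
  have hfin : ∫⁻ x, A x * ENNReal.ofReal √(u x) ≠ ∞ := by
    rw [hφ]; exact ne_top_of_le_ne_top ENNReal.one_ne_top hle
  -- `toReal` sends ∞ to 0, which is harmless: off a null set, A can be infinite only where √u = 0,
  -- and there both products vanish.
  have hT : (fun x => ENNReal.ofReal ((A x).toReal * √(u x)))
      =ᵐ[volume] fun x => A x * ENNReal.ofReal √(u x) := by
    filter_upwards [ae_lt_top (mA.mul mF) hfin] with x hx
    rw [Pi.mul_apply] at hx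
    rw [← ENNReal.ofReal_toReal hx.ne, ENNReal.toReal_mul,
      ENNReal.toReal_ofReal (Real.sqrt_nonneg _)]
  have hnn : ∀ x, 0 ≤ (A x).toReal * √(u x) := fun x =>
    mul_nonneg ENNReal.toReal_nonneg (Real.sqrt_nonneg _)
  have mT : Measurable fun x => (A x).toReal * √(u x) := mA.ennreal_toReal.mul hu.measurable_sqrt
  have hTi : Integrable fun x => (A x).toReal * √(u x) := by
    refine ⟨mT.aestronglyMeasurable, ?_⟩
    rw [hasFiniteIntegral_iff_ofReal (Eventually.of_forall hnn), lintegral_congr_ae hT]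
    exact hfin.lt_top
  have hui : Integrable u := by
    by_contra h
    have := hu.integral_eq_one
    simp [integral_undef h] at this
  unfold approxForm defect
  congr 1
  simp_rw [hu.transitionSemigroup_sqrt hp ht, sub_mul, Real.mul_self_sqrt (hu.nonneg _)]
  rw [integral_sub hui hTi, hu.integral_eq_one,
    integral_eq_lintegral_of_nonneg_ae (Eventually.of_forall hnn) mT.aestronglyMeasurable,
    lintegral_congr_ae hT, hφ]

theorem tendsto_approxForm_iff (hp : IsSymmetricConvolutionFamily p) {l : ℝ} :
    Tendsto (fun t => approxForm p t (fun x => √(u x)) (fun x => √(u x))) (𝓝[>] 0) (𝓝 l)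
      ↔ Tendsto (fun t => t⁻¹ * defect p u t) (𝓝[>] 0) (𝓝 l) := by
  refine tendsto_congr' ?_
  filter_upwards [self_mem_nhdsWithin] with t ht
  exact hu.approxForm_sqrt hp ht

theorem inDomain_sqrt (hp : IsSymmetricConvolutionFamily p) {K : ℝ}
    (hK : ∃ᶠ s in 𝓝[>] (0 : ℝ), defect p u s ≤ K * s) : InDomain p (fun x => √(u x)) := by
  obtain ⟨l, hl⟩ := hu.exists_tendsto_defect hp hK
  exact ⟨hu.memLp_sqrt, l, (hu.tendsto_approxForm_iff hp).2 hl⟩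

/-- Mixing a density over translates lowers the form of its root. -/
theorem defect_le_of_conv (hp : IsSymmetricConvolutionFamily p) {v : Space d → ℝ}
    (hv : IsProperPrior v) {ρ : Space d → ℝ≥0∞} (hρ : Measurable ρ) (hρ1 : ∫⁻ x, ρ x = 1)
    (hconv : ∀ᵐ x, ENNReal.ofReal (v x) = ∫⁻ y, ENNReal.ofReal (u (x - y)) * ρ y)
    {t : ℝ} (ht : 0 < t) : defect p v t ≤ defect p u t := by
  have h := meanAutocorr_sqrt_le_of_conv (q := dens p t) hu.measurable.ennreal_ofReal hρ hρ1 hconv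
  simp_rw [← ofReal_sqrt_eq_rpow (hu.nonneg _), ← ofReal_sqrt_eq_rpow (hv.nonneg _)] at h
  have := ENNReal.toReal_mono
    (ne_top_of_le_ne_top ENNReal.one_ne_top (hv.meanAutocorr_le_one hp ht)) h
  unfold defect
  linarith

end IsProperPrior

/-! ### The marginal as a mixture of translates -/

section Marginal

variable {c : ℝ} {prior : Space d → ℝ} (hp : IsSymmetricConvolutionFamily p) (hc : 0 < c)
  (hprior : IsProperPrior prior)
include hp hc hprior

theorem ofReal_marginal : ∀ᵐ x, ENNReal.ofReal (marginal p c prior x)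
    = ∫⁻ y, ENNReal.ofReal (p c (x - y)) * ENNReal.ofReal (prior y) :=
  ofReal_integral_conv (hp.measurable c hc) hprior.measurable (hp.nonneg c hc) hprior.nonneg
    (hp.integral_eq_one c hc) hprior.integral_eq_one

theorem isProperPrior_marginal : IsProperPrior (marginal p c prior) := by
  have m1 := hp.measurable c hc
  have m2 := hprior.measurable
  have hm : Measurable (marginal p c prior) := by
    unfold marginal
    exact (StronglyMeasurable.integral_prod_right'
      (f := fun a : Space d × Space d => p c (a.1 - a.2) * prior a.2)
      (by fun_prop : Measurable _).stronglyMeasurable).measurable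
  have h0 : ∀ x, 0 ≤ marginal p c prior x := fun x =>
    integral_nonneg fun θ => mul_nonneg (hp.nonneg c hc _) (hprior.nonneg _)
  refine ⟨hm, h0, ?_⟩
  rw [integral_eq_lintegral_of_nonneg_ae (Eventually.of_forall h0) hm.aestronglyMeasurable,
    lintegral_congr_ae (ofReal_marginal hp hc hprior), lintegral_lintegral_swap (by fun_prop)]
  have : ∀ y, ∫⁻ x, ENNReal.ofReal (p c (x - y)) * ENNReal.ofReal (prior y)
      = ENNReal.ofReal (prior y) := fun y => by
    rw [lintegral_mul_const _ (by fun_prop),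
      lintegral_sub_right_eq_self (fun x => ENNReal.ofReal (p c x)) y,
      lintegral_ofReal_eq_one (hp.nonneg c hc) (hp.integral_eq_one c hc), one_mul]
  simp [this, lintegral_ofReal_eq_one hprior.nonneg hprior.integral_eq_one]

theorem defect_marginal_le_prior {t : ℝ} (ht : 0 < t) :
    defect p (marginal p c prior) t ≤ defect p prior t := by
  refine hprior.defect_le_of_conv hp (isProperPrior_marginal hp hc hprior)
    (hp.measurable_dens hc) (hp.lintegral_dens hc) ?_ ht
  filter_upwards [ofReal_marginal hp hc hprior] with x hx
  rw [hx]
  exact lintegral_conv_comm (dens p c) (fun y => ENNReal.ofReal (prior y)) x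

/-- Here the prior is the mixing weight and p_c the mixed density, so the bound does not depend on
the prior. -/
theorem defect_marginal_le_dens {t : ℝ} (ht : 0 < t) :
    defect p (marginal p c prior) t ≤ defect p (p c) t :=
  (hp.isProperPrior hc).defect_le_of_conv hp (isProperPrior_marginal hp hc hprior)
    hprior.measurable.ennreal_ofReal
    (lintegral_ofReal_eq_one hprior.nonneg hprior.integral_eq_one)
    (ofReal_marginal hp hc hprior) ht

end Marginal

theorem IsSymmetricConvolutionFamily.defect_anti_scale (hp : IsSymmetricConvolutionFamily p)
    {a b : ℝ} (ha : 0 < a) (hab : a < b) {t : ℝ} (ht : 0 < t) :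
    defect p (p b) t ≤ defect p (p a) t := by
  have hb : 0 < b - a := sub_pos.2 hab
  refine (hp.isProperPrior ha).defect_le_of_conv hp (hp.isProperPrior (ha.trans hab))
    (hp.measurable_dens hb) (hp.lintegral_dens hb) ?_ ht
  have := hp.dens_add ha hb
  rwa [add_sub_cancel] at this

/-! ### Scale families -/

/-- The affinity `⟨T_t √p_a, √p_{a+t}⟩`. -/
noncomputable def affinity (p : ℝ → Space d → ℝ) (a t : ℝ) : ℝ≥0∞ :=
  ∫⁻ z, ∫⁻ x, ENNReal.ofReal √(p a x) * ENNReal.ofReal √(p (a + t) (x + z)) * dens p t z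

/-- The joint law of two independent noise variables with scale parameters `a` and `t`. -/
noncomputable def noiseLaw (p : ℝ → Space d → ℝ) (a t : ℝ) : Measure (Space d × Space d) :=
  (volume.prod volume).withDensity fun ω => dens p a ω.1 * dens p t ω.2

namespace IsSymmetricConvolutionFamily

variable (hp : IsSymmetricConvolutionFamily p) {a t : ℝ} (ha : 0 < a) (ht : 0 < t)
include hp ha ht

/-- The affinity is ⟨√p_{a+t}, T_t √p_a⟩ by symmetry; then 2⟨G, H⟩ ≤ ‖G‖² + ‖H‖² and ‖T_t F‖² = ⟨F,
T_{2t} F⟩. -/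
theorem two_mul_affinity_le :
    2 * affinity p a t
      ≤ 1 + meanAutocorr (dens p (2 * t)) (fun x => ENNReal.ofReal √(p a x)) := by
  have hat : 0 < a + t := add_pos ha ht
  have mt := hp.measurable_dens ht
  have mpa := hp.measurable a ha
  have mpat := hp.measurable (a + t) hat
  have mk := (hp.isProperPrior ha).measurable_sqrt.ennreal_ofReal
  have mm := (hp.isProperPrior hat).measurable_sqrt.ennreal_ofReal
  set F := fun x => ENNReal.ofReal √(p a x)
  set G := fun x => ENNReal.ofReal √(p (a + t) x)
  have e : affinity p a t = ∫⁻ w, G w * smoothing (dens p t) F w := by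
    calc affinity p a t = ∫⁻ z, (∫⁻ x, F x * G (x + z)) * dens p t z :=
          lintegral_congr fun z => lintegral_mul_const _ (by fun_prop)
      _ = ∫⁻ z, (∫⁻ x, F x * G (x + -z)) * dens p t z :=
          (hp.lintegral_neg_dens ht fun z => ∫⁻ x, F x * G (x + z)).symm
      _ = ∫⁻ z, ∫⁻ w, G w * (F (w + z) * dens p t z) := by
          refine lintegral_congr fun z => ?_
          rw [← lintegral_mul_const _ (by fun_prop), ← lintegral_add_right_eq_self _ z]
          refine lintegral_congr fun w => ?_
          rw [add_neg_cancel_right]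
          ring
      _ = ∫⁻ w, ∫⁻ z, G w * (F (w + z) * dens p t z) := lintegral_lintegral_swap (by fun_prop)
      _ = _ := lintegral_congr fun w => lintegral_const_mul _ (by fun_prop)
  rw [e, hp.meanAutocorr_two_mul ht mk, ← (hp.isProperPrior hat).lintegral_sqrt_sq,
    ← lintegral_add_left (by fun_prop), ← lintegral_const_mul' _ _ (by simp)]
  exact lintegral_mono fun w => two_mul_mul_le_add_sq _ _

theorem lintegral_noiseLaw {Φ : Space d × Space d → ℝ≥0∞} (hΦ : Measurable Φ) :
    ∫⁻ ω, Φ ω ∂noiseLaw p a t = ∫⁻ z, ∫⁻ x, Φ (x, z) * dens p a x * dens p t z := by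
  have ma := hp.measurable_dens ha
  have mt := hp.measurable_dens ht
  unfold noiseLaw
  rw [lintegral_withDensity_eq_lintegral_mul _ (by fun_prop) hΦ,
    lintegral_prod_symm _ (by fun_prop)]
  refine lintegral_congr fun z => lintegral_congr fun x => ?_
  simp only [Pi.mul_apply]
  ring

theorem lintegral_fst_noiseLaw {Φ : Space d → ℝ≥0∞} (hΦ : Measurable Φ) :
    ∫⁻ ω, Φ ω.1 ∂noiseLaw p a t = ∫⁻ x, Φ x * dens p a x := by
  have ma := hp.measurable_dens ha
  have mt := hp.measurable_dens ht
  rw [hp.lintegral_noiseLaw ha ht (Φ := fun ω => Φ ω.1) (by fun_prop)]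
  calc ∫⁻ z, ∫⁻ x, Φ x * dens p a x * dens p t z
      = ∫⁻ z, (∫⁻ x, Φ x * dens p a x) * dens p t z :=
        lintegral_congr fun z => lintegral_mul_const _ (by fun_prop)
    _ = _ := by rw [lintegral_const_mul _ mt, hp.lintegral_dens ht, mul_one]

theorem lintegral_add_noiseLaw {Φ : Space d → ℝ≥0∞} (hΦ : Measurable Φ) :
    ∫⁻ ω, Φ (ω.1 + ω.2) ∂noiseLaw p a t = ∫⁻ x, Φ x * dens p (a + t) x := by
  rw [hp.lintegral_noiseLaw ha ht (Φ := fun ω => Φ (ω.1 + ω.2)) (by fun_prop),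
    hp.lintegral_dens_add ha ht hΦ]

theorem isProbabilityMeasure_noiseLaw : IsProbabilityMeasure (noiseLaw p a t) := by
  constructor
  rw [← lintegral_one, hp.lintegral_fst_noiseLaw ha ht (Φ := fun _ => 1) measurable_const]
  simp [hp.lintegral_dens ha]

/-- The sum of the two noises has density p_{a+t}, and dividing it by r gives the law p_a; along
this dilation the density r^d p_{a+t} becomes p_a. -/
theorem map_noiseLaw_eq {r : ℝ} (hr : 0 < r)
    (hscale : ∀ᵐ x, r ^ d * p (a + t) (r • x) = p a x) :
    (noiseLaw p a t).map (fun ω => p a ω.1)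
      = (noiseLaw p a t).map (fun ω => r ^ d * p (a + t) (ω.1 + ω.2)) := by
  have ma := hp.measurable a ha
  have mat := hp.measurable (a + t) (add_pos ha ht)
  have mD := hp.measurable_dens (add_pos ha ht)
  refine Measure.ext_of_lintegral _ fun g hg => ?_
  rw [lintegral_map hg (by fun_prop), lintegral_map hg (by fun_prop),
    hp.lintegral_fst_noiseLaw ha ht (Φ := fun x => g (p a x)) (by fun_prop),
    hp.lintegral_add_noiseLaw ha ht (Φ := fun x => g (r ^ d * p (a + t) x)) (by fun_prop),
    ← lintegral_comp_smul_mul hr (f := fun x => g (r ^ d * p (a + t) x) * dens p (a + t) x)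
      (by fun_prop)]
  refine lintegral_congr_ae ?_
  filter_upwards [hscale] with x hx
  rw [← hx, dens, dens, ← hx, mul_assoc, ← ENNReal.ofReal_mul' (by positivity), mul_comm (p _ _)]

theorem lintegral_sqrt_ratio_noiseLaw :
    ∫⁻ ω, ENNReal.ofReal √(p (a + t) (ω.1 + ω.2) / p a ω.1) ∂noiseLaw p a t = affinity p a t := by
  have ma := hp.measurable a ha
  have mat := hp.measurable (a + t) (add_pos ha ht)
  rw [hp.lintegral_noiseLaw ha ht
    (Φ := fun ω => ENNReal.ofReal √(p (a + t) (ω.1 + ω.2) / p a ω.1)) (by fun_prop)]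
  refine lintegral_congr fun z => lintegral_congr fun x => ?_
  congr 1
  unfold dens
  have h0 := hp.nonneg a ha x
  rw [← ENNReal.ofReal_mul (Real.sqrt_nonneg _), ← ENNReal.ofReal_mul (Real.sqrt_nonneg _)]
  congr 1
  simp only
  rw [Real.sqrt_div' _ h0]
  -- If p_a(x) = 0, the quotient has the default value 0 and both sides vanish.
  rcases h0.eq_or_lt with h | h
  · simp [← h]
  · have h1 := Real.sqrt_pos.2 h
    nth_rewrite 2 [← Real.mul_self_sqrt h0]
    field_simp

/-- The relative entropy bound: the affinity is controlled by the growth of the dilation factor. -/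
theorem one_sub_affinity_le {r : ℝ} (hr : 0 < r)
    (hscale : ∀ᵐ x, r ^ d * p (a + t) (r • x) = p a x) :
    2 * (1 - (affinity p a t).toReal) ≤ d * Real.log r := by
  have hat : 0 < a + t := add_pos ha ht
  have ma := hp.measurable a ha
  have mat := hp.measurable (a + t) hat
  have := hp.isProbabilityMeasure_noiseLaw ha ht
  set P := noiseLaw p a t with hP
  have hmap := hp.map_noiseLaw_eq ha ht hr hscale
  have hafin : affinity p a t ≠ ∞ := by
    have h1 := hp.two_mul_affinity_le ha ht
    have h2 := (hp.isProperPrior ha).meanAutocorr_le_one hp (t := 2 * t) (by positivity)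
    intro h
    rw [h, ENNReal.mul_top (by simp)] at h1
    have h3 := h1.trans (add_le_add_right h2 1)
    norm_num at h3
  set W : Space d × Space d → ℝ := fun ω => √(p (a + t) (ω.1 + ω.2) / p a ω.1) with hW
  have mW : Measurable W := by fun_prop
  have hW0 : ∀ ω, 0 ≤ W ω := fun ω => Real.sqrt_nonneg _
  have hWl : ∫⁻ ω, ENNReal.ofReal (W ω) ∂P = affinity p a t :=
    hp.lintegral_sqrt_ratio_noiseLaw ha ht
  have hWi : Integrable W P := by
    refine ⟨mW.aestronglyMeasurable, ?_⟩
    rw [hasFiniteIntegral_iff_ofReal (Eventually.of_forall hW0), hWl]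
    exact hafin.lt_top
  have hWint : ∫ ω, W ω ∂P = (affinity p a t).toReal := by
    rw [integral_eq_lintegral_of_nonneg_ae (Eventually.of_forall hW0) mW.aestronglyMeasurable, hWl]
  have hpos1 : ∀ᵐ ω ∂P, 0 < p a ω.1 := by
    have mda := hp.measurable_dens ha
    have mdt := hp.measurable_dens ht
    rw [hP, noiseLaw, ae_withDensity_iff (by fun_prop)]
    refine Eventually.of_forall fun ω h => ?_
    exact ENNReal.ofReal_pos.1 (pos_iff_ne_zero.2 (left_ne_zero_of_mul h))
  -- Positivity carries over from p_a(X) through the equality of laws.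
  have hpos2 : ∀ᵐ ω ∂P, 0 < r ^ d * p (a + t) (ω.1 + ω.2) := by
    rw [← ae_map_iff (p := fun y : ℝ => 0 < y) (by fun_prop) measurableSet_Ioi] at hpos1 ⊢
    rwa [← hmap]
  -- Here 2 log W = V - U - d log r, so log W ≤ W - 1 gives U - V ≥ Y. U and V have the same law but
  -- need not be integrable, hence the truncated means.
  have key := integral_nonpos_of_le_sub (P := P) (U := fun ω => Real.log (p a ω.1))
    (V := fun ω => Real.log (r ^ d * p (a + t) (ω.1 + ω.2)))
    (Y := fun ω => (2 - d * Real.log r) - 2 * W ω) (by fun_prop) (by fun_prop)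
    ((integrable_const _).sub (hWi.const_mul 2)) (fun N => ?_) ?_
  · rw [integral_sub (integrable_const _) (hWi.const_mul 2), integral_const, integral_const_mul,
      hWint] at key
    simp at key
    linarith
  · have h1 := integral_map (μ := P) (φ := fun ω => p a ω.1) (by fun_prop)
      (f := fun y => max (-N : ℝ) (min N (Real.log y))) (by fun_prop)
    have h2 := integral_map (μ := P) (φ := fun ω => r ^ d * p (a + t) (ω.1 + ω.2)) (by fun_prop)
      (f := fun y => max (-N : ℝ) (min N (Real.log y))) (by fun_prop)
    rw [← h1, ← h2, hmap]
  · filter_upwards [hpos1, hpos2] with ω h1 h2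
    have h3 : 0 < p (a + t) (ω.1 + ω.2) := pos_of_mul_pos_right h2 (by positivity)
    have h4 := Real.log_le_sub_one_of_pos (Real.sqrt_pos.2 (div_pos h3 h1))
    rw [Real.log_sqrt (div_pos h3 h1).le, Real.log_div h3.ne' h1.ne'] at h4
    rw [Real.log_mul (by positivity) h3.ne', Real.log_pow]
    simp only [hW]
    linarith

theorem defect_dens_le {r : ℝ} (hr : 0 < r)
    (hscale : ∀ᵐ x, r ^ d * p (a + t) (r • x) = p a x) :
    defect p (p a) (2 * t) ≤ d * Real.log r := by
  have h1 := hp.two_mul_affinity_le ha ht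
  have h2 := (hp.isProperPrior ha).meanAutocorr_le_one hp (t := 2 * t) (by positivity)
  have h2' := ne_top_of_le_ne_top ENNReal.one_ne_top h2
  have h3 := hp.one_sub_affinity_le ha ht hr hscale
  have h4 := ENNReal.toReal_mono (by simp [h2']) h1
  rw [ENNReal.toReal_add (by simp) h2', ENNReal.toReal_mul] at h4
  simp at h4
  unfold defect
  linarith

omit ha ht in
-- Each scale a in [c/2, c) has defect at least that of c, so n times the defect of p_c at time c/n
-- is at most a telescoping sum of d log σ over [c/2, c]. No regularity of σ is needed.
theorem frequently_defect_dens_le (hs : IsScaleFamily p) {c : ℝ} (hc : 0 < c) :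
    ∃ K : ℝ, ∃ᶠ s in 𝓝[>] (0 : ℝ), defect p (p c) s ≤ K * s := by
  choose! σ hσ hσp using hs
  have hbound : ∀ a t, 0 < a → 0 < t →
      defect p (p a) (2 * t) ≤ d * (Real.log (σ (a + t)) - Real.log (σ a)) := by
    intro a t ha ht
    have h1 := hσ a ha
    have h2 := hσ (a + t) (add_pos ha ht)
    rw [← Real.log_div h2.ne' h1.ne']
    refine hp.defect_dens_le ha ht (div_pos h2 h1) ?_
    filter_upwards [hσp a ha, (Measure.quasiMeasurePreserving_smul volume
      (div_pos h2 h1).ne').ae (hσp (a + t) (add_pos ha ht))] with x hx hy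
    rw [hx, hy, smul_smul, div_pow]
    have e : (σ (a + t))⁻¹ * (σ (a + t) / σ a) = (σ a)⁻¹ := by field_simp
    rw [e]
    field_simp
  set K := d * (Real.log (σ c) - Real.log (σ (c / 2)))
  have hn : ∀ n : ℕ, 0 < n → defect p (p c) (c / n) ≤ K / c * (c / n) := by
    intro n hn
    have hn' : (0 : ℝ) < n := by exact_mod_cast hn
    -- Then n steps of length t lead from c/2 to c, while the defect is taken at time 2t = c/n.
    set t := c / (2 * n) with ht
    have ht0 : 0 < t := by positivity
    have e2 : c / n = 2 * t := by rw [ht]; field_simp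
    have hnt : n * t = c / 2 := by rw [ht]; field_simp
    have hsum : ∑ k ∈ Finset.range n, defect p (p c) (2 * t) ≤ ∑ k ∈ Finset.range n,
        (d * Real.log (σ (c / 2 + (k + 1 : ℕ) * t)) - d * Real.log (σ (c / 2 + k * t))) := by
      refine Finset.sum_le_sum fun k hk => ?_
      have hkn : (k : ℝ) < n := by exact_mod_cast Finset.mem_range.1 hk
      have hlt : c / 2 + k * t < c := by nlinarith
      have h0 : 0 < c / 2 + k * t := by positivity
      have h1 := hbound _ t h0 ht0
      have h2 := hp.defect_anti_scale h0 hlt (t := 2 * t) (by positivity)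
      rw [show c / 2 + (k + 1 : ℕ) * t = c / 2 + k * t + t by push_cast; ring]
      linarith
    rw [Finset.sum_range_sub (fun k : ℕ => d * Real.log (σ (c / 2 + k * t))), hnt] at hsum
    simp only [Finset.sum_const, Finset.card_range, nsmul_eq_mul, Nat.cast_zero, zero_mul,
      add_zero, add_halves] at hsum
    rw [e2, show K / c * (2 * t) = K / n by rw [← e2]; field_simp, le_div_iff₀ hn']
    simp only [K]
    linarith
  refine ⟨K / c, Tendsto.frequently (f := fun n : ℕ => c / n) (l₁ := atTop) ?_ ?_⟩
  · rw [tendsto_nhdsWithin_iff]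
    refine ⟨tendsto_const_div_atTop_nhds_zero_nat c, ?_⟩
    filter_upwards [eventually_gt_atTop 0] with n hn
    have : (0 : ℝ) < n := by exact_mod_cast hn
    exact div_pos hc this
  · exact (eventually_gt_atTop 0).frequently.mono hn

end IsSymmetricConvolutionFamily

end PredictiveDirichlet

/-! ### The main theorem -/

open PredictiveDirichlet
theorem mainTheorem9 {d : ℕ} (hd : 0 < d) (p : ℝ → Space d → ℝ)
    (hp : IsSymmetricConvolutionFamily p) (c : ℝ) (hc : 0 < c)
    (prior : Space d → ℝ) (hprior : IsProperPrior prior) :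
    (IsScaleFamily p → InDomain p (fun x => √(marginal p c prior x))) ∧
    (InDomain p (fun θ => √(prior θ)) →
      InDomain p (fun x => √(marginal p c prior x)) ∧
      dirichletForm p (fun x => √(marginal p c prior x)) (fun x => √(marginal p c prior x)) ≤
        dirichletForm p (fun θ => √(prior θ)) (fun θ => √(prior θ))) := by
  have hM := isProperPrior_marginal hp hc hprior
  refine ⟨fun hs => ?_, fun hdom => ?_⟩
  · obtain ⟨K, hK⟩ := hp.frequently_defect_dens_le hs hc
    refine hM.inDomain_sqrt hp (K := K) ((hK.and_eventually self_mem_nhdsWithin).mono ?_)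
    exact fun s hs => (defect_marginal_le_dens hp hc hprior hs.2).trans hs.1
  · obtain ⟨l, hl⟩ := hdom.2
    have hl' := (hprior.tendsto_approxForm_iff hp).1 hl
    have hMdom : InDomain p (fun x => √(marginal p c prior x)) := by
      -- Any constant above the limit l eventually bounds the quotient for the prior, hence that for
      -- the marginal.
      refine hM.inDomain_sqrt hp (K := l + 1) (Eventually.frequently ?_)
      filter_upwards [hl'.eventually (gt_mem_nhds (lt_add_one l)), self_mem_nhdsWithin] with s h hs
      have hs : 0 < s := hs
      rw [inv_mul_lt_iff₀ hs] at h
      have := defect_marginal_le_prior hp hc hprior hs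
      linarith
    refine ⟨hMdom, ?_⟩
    obtain ⟨m, hm⟩ := hMdom.2
    unfold dirichletForm
    rw [hl.limUnder_eq, hm.limUnder_eq]
    refine le_of_tendsto_of_tendsto ((hM.tendsto_approxForm_iff hp).1 hm) hl' ?_
    filter_upwards [self_mem_nhdsWithin] with t ht
    have ht : 0 < t := ht
    exact mul_le_mul_of_nonneg_left (defect_marginal_le_prior hp hc hprior ht) (by positivity)
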